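/- Let $f,g\in\mathbb C[x_1,x_2,x_3]$ and let $C=\{x\in\mathbb C^3: f(x)=g(x)=0\}$. Assume that $C$ is regular, i.e. the Jacobian matrix $\partial(f,g)/\partial(x_1,x_2,x_3)$ has rank $2$ at every point of $C$, and that no component of $C$ lies in a plane $x_i=\mathrm{const}$ (no coordinate function is locally constant on $C$ at any point). Put $$J^i(x)=\sum_{k,l}\epsilon^{ikl}\,\frac{\partial f}{\partial x_k}(x)\,\frac{\partial g}{\partial x_l}(x),\qquad \epsilon^{123}=1,$$ $$N^1(x,y)=f(y_1,y_2,x_3)g(x_1,y_2,x_3)-f(x_1,y_2,x_3)g(y_1,y_2,x_3),$$ $$N^2(x,y)=f(x_1,y_2,y_3)g(x_1,x_2,y_3)-f(x_1,x_2,y_3)g(x_1,y_2,y_3),$$ $$N^3(x,y)=f(y_1,x_2,y_3)g(y_1,x_2,x_3)-f(y_1,x_2,x_3)g(y_1,x_2,y_3),$$ $$K_{\rm sym}(x,y)=\frac13\sum_{i=1}^3\frac{N^i(x,y)}{J^i(x)}\,\frac{dx_i}{(x_1-y_1)(x_2-y_2)(x_3-y_3)},\qquad K(x,y)=\frac{N^1(x,y)}{J^1(x)}\,\frac{dx_1}{(x_1-y_1)(x_2-y_2)(x_3-y_3)}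 .$$ Then $C$ has a holomorphic local parametrization at each of its points (with nonzero derivative, and mapping the neighbourhoods of $0$ onto the neighbourhoods of the point in $C$), and each kernel $\mathcal K\in\{K_{\rm sym},K\}$, restricted to $x,y\in C$, has the following properties. Identities between $\mathcal K$ and holomorphic functions are asserted where the denominators of $\mathcal K$ do not vanish. 1. For fixed $y\in C$ the denominators of $\mathcal K(\cdot,y)$ vanish at most at isolated points of $C$. $\mathcal K$ is meromorphic as a differential in $x$ for fixed $y\in C$ and as a function of $y$ for fixed $x\in C$ (where its formula is defined), also at the points at infinity, i.e. along every punctured arc $t\mapsto x(t)\in C$, $0<|t|<\varepsilon$, whose coordinates are meromorphic at $t=0$. 2. (Simple pole with residue $1$ at $x=y$.) If $t\mapsto\gamma(t)$ is a holomorphic local parametrization of $C$ at $p=\gamma(0)$, then for $x=\gamma(t)$, $y=\gamma(s)$ near $p$ one has $\mathcal K(x,y)=\left(\frac1{t-s}+A(t,s)\right)dt$ with $A$ holomorphic at $(0,0)$. If $J^1(p)\neq0$, so that $x_1$ is a local coordinate at $p$, then $\mathcal K(x,y)=\frac{dx_1}{x_1-y_1}+A(t,s)\,dt$ with some $A$ holomorphic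 at $(0,0)$. 3. (No other poles at finite points.) If $p\ne q$ are points of $C$, with holomorphic local parametrizations $\gamma$ at $p$ and $\delta$ at $q$, then $\mathcal K(\gamma(t),\delta(s))=A(t,s)\,dt$ with $A$ holomorphic at $(0,0)$; this includes the pairs with $J^i(p)=0$ for some $i$ and those for which some but not all coordinates of $p$ and $q$ coincide. 4. (Location of the poles.) Let $\gamma,\delta$ be punctured arcs in $C$ with meromorphic coordinates. If $\mathcal K(\gamma(t),\delta(s))$ is not of the form $A(t,s)\,dt$, for small $t,s\neq0$, with $A$ holomorphic at $(0,0)$, then $\gamma(t)$ and $\delta(s)$ tend to the same point of $C$ as $t,s\to0$, or some coordinate of $\gamma(t)$ or of $\delta(s)$ tends to infinity. -/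

import Mathlib

open Filter Topology

namespace SpaceCurve

noncomputable section

/-- Affine space `ℂ³`; the coordinates `x₁, x₂, x₃` are `x 0, x 1, x 2`. -/
abbrev Pt : Type := Fin 3 → ℂ

/-- Polynomials in three variables. -/
abbrev Poly : Type := MvPolynomial (Fin 3) ℂ

/-- The affine curve `f = g = 0`. -/
def curve (f g : Poly) : Set Pt :=
  {x | MvPolynomial.eval x f = 0 ∧ MvPolynomial.eval x g = 0}

/-- The vector of first partial derivatives of `f` at `x`. -/
def grad (f : Poly) (x : Pt) : Pt := fun k => MvPolynomial.eval x (MvPolynomial.pderiv k f)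

/-- Regularity: at every point of the curve the Jacobian matrix of `(f, g)` has rank two. -/
def IsRegular (f g : Poly) : Prop :=
  ∀ x ∈ curve f g, (Matrix.of ![grad f x, grad g x]).rank = 2

/-- No coordinate function is locally constant at a point of the curve, that is, no component
of the curve lies in a plane `xᵢ = const`. -/
def CoordsNonconstant (f g : Poly) : Prop :=
  ∀ i : Fin 3, ∀ p ∈ curve f g, ∃ᶠ x in 𝓝[curve f g] p, x i ≠ p i

/-- The Jacobians `Jⁱ(x) = ε^{ikl} ∂ₖf(x) ∂ₗg(x)`, the components of the cross product of the two
gradients. -/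
def J (f g : Poly) (i : Fin 3) (x : Pt) : ℂ := crossProduct (grad f x) (grad g x) i

/-- The numerators `N¹, N², N³`. -/
def N (f g : Poly) (i : Fin 3) (x y : Pt) : ℂ :=
  let f' (a b c : ℂ) : ℂ := MvPolynomial.eval ![a, b, c] f
  let g' (a b c : ℂ) : ℂ := MvPolynomial.eval ![a, b, c] g
  ![f' (y 0) (y 1) (x 2) * g' (x 0) (y 1) (x 2) - f' (x 0) (y 1) (x 2) * g' (y 0) (y 1) (x 2),
    f' (x 0) (y 1) (y 2) * g' (x 0) (x 1) (y 2) - f' (x 0) (x 1) (y 2) * g' (x 0) (y 1) (y 2),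
    f' (y 0) (x 1) (y 2) * g' (y 0) (x 1) (x 2) - f' (y 0) (x 1) (x 2) * g' (y 0) (x 1) (y 2)] i

/-- The coordinate differential `dxᵢ`. -/
def dx (i : Fin 3) : Pt →L[ℂ] ℂ := ContinuousLinearMap.proj i

/-- The product `(x₁ - y₁)(x₂ - y₂)(x₃ - y₃)`. -/
def diffProd (x y : Pt) : ℂ := (x 0 - y 0) * (x 1 - y 1) * (x 2 - y 2)

/-- The kernel `K(x, y) = N¹/J¹ · dx₁ / ((x₁ - y₁)(x₂ - y₂)(x₃ - y₃))`, a differential form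
in `x`. -/
def K (f g : Poly) (x y : Pt) : Pt →L[ℂ] ℂ :=
  (N f g 0 x y / J f g 0 x / diffProd x y) • dx 0

/-- The kernel `K_sym(x, y) = 1/3 ∑ᵢ Nⁱ/Jⁱ · dxᵢ / ((x₁ - y₁)(x₂ - y₂)(x₃ - y₃))`. -/
def Ksym (f g : Poly) (x y : Pt) : Pt →L[ℂ] ℂ :=
  (1 / 3 : ℂ) • ∑ i : Fin 3, (N f g i x y / J f g i x / diffProd x y) • dx i

/-- The pairs at which no denominator of `K` vanishes. -/
def KDefined (f g : Poly) (x y : Pt) : Prop := J f g 0 x ≠ 0 ∧ ∀ i : Fin 3, x i ≠ y i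

/-- The pairs at which no denominator of `Ksym` vanishes. -/
def KsymDefined (f g : Poly) (x y : Pt) : Prop :=
  (∀ i : Fin 3, J f g i x ≠ 0) ∧ ∀ i : Fin 3, x i ≠ y i

/-- `γ` is a holomorphic local parametrization of the curve at `p`: the inverse of a local
coordinate `t` with `t = 0` at `p`. -/
structure IsLocalParam (f g : Poly) (γ : ℂ → Pt) (p : Pt) : Prop where
  analyticAt : AnalyticAt ℂ γ 0
  map_zero : γ 0 = p
  deriv_ne_zero : deriv γ 0 ≠ 0
  mem_curve : ∀ᶠ t in 𝓝 (0 : ℂ), γ t ∈ curve f g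

/-- A punctured arc of the curve along which the coordinates are meromorphic, such as the
expansion of `(x₁, x₂, x₃)` in a local parameter at a finite or infinite point of the associated
compact Riemann surface. The value `γ 0` is irrelevant. -/
structure IsArc (f g : Poly) (γ : ℂ → Pt) : Prop where
  meromorphicAt : ∀ i : Fin 3, MeromorphicAt (fun t => γ t i) 0
  mem_curve : ∀ᶠ t in 𝓝[≠] (0 : ℂ), γ t ∈ curve f g

/-- The asserted properties of a kernel `κ(x, y)` (a differential form in `x`, a function of `y`)
that is given by a formula whose denominators do not vanish on `dom`. -/
structure IsWeierstrassKernel (f g : Poly) (κ : Pt → Pt → Pt →L[ℂ] ℂ)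
    (dom : Pt → Pt → Prop) : Prop where
  /-- For fixed `y` the denominators vanish at most at isolated points `x` of the curve. -/
  eventually_dom : ∀ p ∈ curve f g, ∀ q ∈ curve f g, ∀ᶠ x in 𝓝[curve f g \ {p}] p, dom x q
  /-- The kernel is a meromorphic differential in `x`. -/
  meromorphic_left : ∀ γ : ℂ → Pt, IsArc f g γ → ∀ y ∈ curve f g,
    MeromorphicAt (fun t => κ (γ t) y (deriv γ t)) 0
  /-- The kernel is a meromorphic function of `y`. -/
  meromorphic_right : ∀ δ : ℂ → Pt, IsArc f g δ → ∀ x ∈ curve f g, ∀ v : Pt,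
    MeromorphicAt (fun s => κ x (δ s) v) 0
  /-- Simple pole with residue one at `x = y`: in any local coordinate `t` of `x` and `s` of `y`
  near a common point of the curve, the kernel is `dt / (t - s)` plus a holomorphic term. -/
  simple_pole : ∀ p ∈ curve f g, ∀ γ : ℂ → Pt, IsLocalParam f g γ p →
    ∃ A : ℂ × ℂ → ℂ, AnalyticAt ℂ A (0, 0) ∧ ∀ᶠ z in 𝓝 ((0, 0) : ℂ × ℂ),
      dom (γ z.1) (γ z.2) →
        κ (γ z.1) (γ z.2) (deriv γ z.1) = 1 / (z.1 - z.2) + A z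
  /-- Where `x₁` is a good local coordinate, the kernel is `dx₁ / (x₁ - y₁)` plus a holomorphic
  term. -/
  asymptotic : ∀ p ∈ curve f g, J f g 0 p ≠ 0 → ∀ γ : ℂ → Pt, IsLocalParam f g γ p →
    ∃ A : ℂ × ℂ → ℂ, AnalyticAt ℂ A (0, 0) ∧ ∀ᶠ z in 𝓝 ((0, 0) : ℂ × ℂ),
      dom (γ z.1) (γ z.2) →
        κ (γ z.1) (γ z.2) (deriv γ z.1) =
          (1 / (γ z.1 0 - γ z.2 0)) * dx 0 (deriv γ z.1) + A z
  /-- No pole at a pair of distinct points of the affine curve, whether or not some of the `Jⁱ`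
  vanish there or some of the coordinates coincide. -/
  no_other_pole : ∀ p ∈ curve f g, ∀ q ∈ curve f g, p ≠ q →
    ∀ γ δ : ℂ → Pt, IsLocalParam f g γ p → IsLocalParam f g δ q →
    ∃ A : ℂ × ℂ → ℂ, AnalyticAt ℂ A (0, 0) ∧ ∀ᶠ z in 𝓝 ((0, 0) : ℂ × ℂ),
      dom (γ z.1) (δ z.2) → κ (γ z.1) (δ z.2) (deriv γ z.1) = A z
  /-- Any pole in `(x, y)`, points at infinity included, lies at `x = y` or where a coordinate of
  `x` or `y` tends to infinity. -/
  pole_location : ∀ γ δ : ℂ → Pt, IsArc f g γ → IsArc f g δ →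
    (∃ A : ℂ × ℂ → ℂ, AnalyticAt ℂ A (0, 0) ∧ ∀ᶠ z in 𝓝 ((0, 0) : ℂ × ℂ),
      z.1 ≠ 0 → z.2 ≠ 0 → dom (γ z.1) (δ z.2) →
        κ (γ z.1) (δ z.2) (deriv γ z.1) = A z) ∨
    (∃ p ∈ curve f g, Tendsto γ (𝓝[≠] 0) (𝓝 p) ∧ Tendsto δ (𝓝[≠] 0) (𝓝 p)) ∨
    (∃ i : Fin 3, Tendsto (fun t => γ t i) (𝓝[≠] 0) (Bornology.cobounded ℂ)) ∨
    (∃ i : Fin 3, Tendsto (fun t => δ t i) (𝓝[≠] 0) (Bornology.cobounded ℂ))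

end

end SpaceCurve

/-! Join `x` to `y` by changing one coordinate at a time, through the inner vertices `w` and `w'`.
`Nᵐ` is the determinant of the values of `(f, g)` at `w'` and `w`, for the path that changes the
coordinates `m + 1, m, m + 2` modulo 3. Since `f` and `g` vanish at both ends of the path, the value
vectors at `w` and `w'` and their difference are, up to sign, coordinate differences times divided
differences. Any two of these three vectors give the same determinant up to sign, so for every `i`
one gets `Nᵐ / ∏ (xₙ - yₙ) = H / (xᵢ - yᵢ)` with `H` holomorphic and equal to `Jⁱ` on the diagonal
(`exists_N_mul_sub_eq`).

The tangent of the curve is proportional to `J`, so `dxₘ / Jᵐ = c dt` with the same holomorphic `c`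
for all `m`, also where some `Jᵐ` vanish (`exists_deriv_eq_mul_J`). Hence any weighted mean of the
three kernels with total weight one is `a / (xᵢ - yᵢ) dt`, where `i` is free and `a = dxᵢ/dt` on the
diagonal (`exists_weightedKernel_eq_div`). At distinct points take `i` with `pᵢ ≠ qᵢ`: there is no
pole. On the diagonal take `i` with `γᵢ' ≠ 0`: Hadamard division gives a simple pole of residue one.
`K` and `Ksym` are two choices of weights. -/

namespace SpaceCurve

/-! ### Hadamard division for analytic functions. -/

section Hadamard

variable {𝕜 E F : Type*} [NontriviallyNormedField 𝕜] [NormedAddCommGroup E] [NormedSpace 𝕜 E]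
  [NormedAddCommGroup F] [NormedSpace 𝕜 F]

/-- The multilinear map with `p(z, …, z) - p(P z, …, P z) = c • (divDiffMultilinear P e p)(z, …, z)`
whenever `z - P z = c • e`. -/
noncomputable def divDiffMultilinear (P : E →L[𝕜] E) (e : E) {n : ℕ} (p : E [×(n + 1)]→L[𝕜] F) :
    E [×n]→L[𝕜] F :=
  ∑ k : Fin (n + 1), (p.curryMid k e).compContinuousLinearMap
    (fun i => if k.succAbove i < k then ContinuousLinearMap.id 𝕜 E else P)

/-- Telescoping: replace `z` by `P z` one slot at a time. In the `k`-th difference the slots before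
`k` hold `z`, those after it hold `P z`, and slot `k` holds `z - P z = c • e`. -/
theorem smul_divDiffMultilinear (P : E →L[𝕜] E) (e : E) {n : ℕ} (p : E [×(n + 1)]→L[𝕜] F)
    {z : E} {c : 𝕜} (h : z - P z = c • e) :
    c • divDiffMultilinear P e p (fun _ => z) = p (fun _ => z) - p (fun _ => P z) := by
  have key := p.toMultilinearMap.map_piecewise_sub_map_piecewise (fun _ => z) (fun _ => P z)
    (fun _ => 0) Finset.univ
  simp only [Finset.piecewise_univ, Finset.mem_univ, if_true,
    ContinuousMultilinearMap.coe_coe] at key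
  rw [key, divDiffMultilinear, _root_.sum_apply, Finset.smul_sum]
  refine Finset.sum_congr rfl fun k _ => ?_
  rw [ContinuousMultilinearMap.compContinuousLinearMap_apply,
    ContinuousMultilinearMap.curryMid_apply, ← ContinuousMultilinearMap.coe_coe,
    ← MultilinearMap.map_insertNth_smul]
  congr 1
  ext j
  refine Fin.succAboveCases k ?_ (fun i => ?_) j
  · simp [h]
  · by_cases hlt : k.succAbove i < k <;> simp [hlt]

theorem norm_divDiffMultilinear_le {P : E →L[𝕜] E} (hP : ‖P‖ ≤ 1) (e : E) {n : ℕ}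
    (p : E [×(n + 1)]→L[𝕜] F) : ‖divDiffMultilinear P e p‖ ≤ (n + 1) * (‖p‖ * ‖e‖) := by
  refine (norm_sum_le _ _).trans ?_
  have hk : ∀ k ∈ (Finset.univ : Finset (Fin (n + 1))),
      ‖(p.curryMid k e).compContinuousLinearMap
        (fun i => if k.succAbove i < k then ContinuousLinearMap.id 𝕜 E else P)‖ ≤ ‖p‖ * ‖e‖ := by
    intro k _
    refine (ContinuousMultilinearMap.norm_compContinuousLinearMap_le _ _).trans ?_
    have h1 : ‖p.curryMid k e‖ ≤ ‖p‖ * ‖e‖ := by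
      simpa using (p.curryMid k).le_opNorm e
    refine (mul_le_of_le_one_right (norm_nonneg _)
      (Finset.prod_le_one (fun _ _ => norm_nonneg _) fun i _ => ?_)).trans h1
    split_ifs
    · exact ContinuousLinearMap.norm_id_le
    · exact hP
  simpa using Finset.sum_le_sum hk

/-- Hadamard's lemma for analytic functions. -/
theorem exists_analyticAt_sub_eq_smul [CompleteSpace F] {f : E → F} (hf : AnalyticAt 𝕜 f 0)
    {P : E →L[𝕜] E} (hP : ‖P‖ ≤ 1) {φ : E → 𝕜} {e : E} (hφ : ∀ z, z - P z = φ z • e) :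
    ∃ G : E → F, AnalyticAt 𝕜 G 0 ∧ ∀ᶠ z in 𝓝 0, f z - f (P z) = φ z • G z := by
  obtain ⟨p, R, hp⟩ := hf
  obtain ⟨r, hr0, hrR⟩ := ENNReal.lt_iff_exists_nnreal_btwn.1 hp.r_pos
  have hr0 : 0 < r := by exact_mod_cast hr0
  obtain ⟨a, ha, C, hC, hbound⟩ :=
    p.norm_mul_pow_le_mul_pow_of_lt_radius (hrR.trans_le hp.r_le)
  let q : FormalMultilinearSeries 𝕜 E F := fun n => divDiffMultilinear P e (p (n + 1))
  -- The geometric decay `a ^ n` gained from `r` being below the radius absorbs the factor `n + 1`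
  -- of the norm bound.
  obtain ⟨B, hB⟩ : ∃ B : ℝ, ∀ n : ℕ, (n + 1 : ℝ) * a ^ (n + 1) ≤ B := by
    have := tendsto_self_mul_const_pow_of_lt_one ha.1.le ha.2
    obtain ⟨B, hB⟩ := this.bddAbove_range
    exact ⟨B, fun n => by simpa using hB ⟨n + 1, rfl⟩⟩
  have hq : (r : ENNReal) ≤ q.radius := by
    refine q.le_radius_of_bound (‖e‖ * (C / r) * B) fun n => ?_
    have hr : (0 : ℝ) < r := hr0
    have h2 : ‖p (n + 1)‖ * (r : ℝ) ^ n ≤ C / r * a ^ (n + 1) := by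
      rw [div_mul_eq_mul_div, le_div_iff₀ hr, mul_assoc, ← pow_succ]
      exact hbound (n + 1)
    calc ‖q n‖ * (r : ℝ) ^ n ≤ (n + 1) * (‖p (n + 1)‖ * ‖e‖) * (r : ℝ) ^ n := by
          gcongr; exact norm_divDiffMultilinear_le hP e _
      _ = (n + 1) * ‖e‖ * (‖p (n + 1)‖ * (r : ℝ) ^ n) := by ring
      _ ≤ (n + 1) * ‖e‖ * (C / r * a ^ (n + 1)) := by gcongr
      _ = ‖e‖ * (C / r) * ((n + 1) * a ^ (n + 1)) := by ring
      _ ≤ ‖e‖ * (C / r) * B := by gcongr; exact hB n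
  have hqpos : 0 < q.radius := lt_of_lt_of_le (by exact_mod_cast hr0) hq
  have hG := q.hasFPowerSeriesOnBall hqpos
  refine ⟨q.sum, hG.analyticAt, ?_⟩
  filter_upwards [Metric.eball_mem_nhds (0 : E) hqpos, Metric.eball_mem_nhds (0 : E) hp.r_pos]
    with z hz hz'
  have hPz : P z ∈ Metric.eball (0 : E) R := by
    rw [mem_eball_zero_iff] at hz' ⊢
    refine lt_of_le_of_lt ?_ hz'
    rw [enorm_le_iff_norm_le]
    exact P.le_of_opNorm_le hP z |>.trans (by simp)
  have h1 := (hp.hasSum hz').sub (hp.hasSum hPz)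
  have h2 := (hG.hasSum hz).const_smul (φ z)
  simp only [zero_add] at h1 h2
  -- The constant terms cancel, and `q n` comes from `p (n + 1)`, so the sum is shifted by one.
  rw [← hasSum_nat_add_iff' 1] at h1
  have h0 : p 0 (fun _ => z) - p 0 (fun _ => P z) = 0 := by
    rw [sub_eq_zero]; congr 1; ext i; exact i.elim0
  simp only [Finset.sum_range_one, h0, sub_zero] at h1
  refine h1.unique ?_
  convert h2 using 1
  ext n
  exact (smul_divDiffMultilinear P e (p (n + 1)) (hφ z)).symm

/-- Division by `t - s` of an analytic function that vanishes on the diagonal. -/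
theorem exists_analyticAt_eq_sub_mul [CompleteSpace 𝕜] {H : 𝕜 × 𝕜 → 𝕜}
    (hH : AnalyticAt 𝕜 H (0, 0)) (hdiag : ∀ᶠ t in 𝓝 (0 : 𝕜), H (t, t) = 0) :
    ∃ G : 𝕜 × 𝕜 → 𝕜, AnalyticAt 𝕜 G (0, 0) ∧ ∀ᶠ z in 𝓝 ((0, 0) : 𝕜 × 𝕜),
      H z = (z.1 - z.2) * G z := by
  -- `P (t, s) = (s, s)`, so `z - P z = (t - s) • (1, 0)`.
  let P : 𝕜 × 𝕜 →L[𝕜] 𝕜 × 𝕜 :=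
    (ContinuousLinearMap.snd 𝕜 𝕜 𝕜).prod (ContinuousLinearMap.snd 𝕜 𝕜 𝕜)
  have hP : ‖P‖ ≤ 1 := by
    refine P.opNorm_le_bound zero_le_one fun z => ?_
    simp [P, Prod.norm_def]
  obtain ⟨G, hG, hHG⟩ := exists_analyticAt_sub_eq_smul (f := H) hH hP
    (φ := fun z => z.1 - z.2) (e := ((1 : 𝕜), (0 : 𝕜))) (fun z => by ext <;> simp [P])
  refine ⟨G, hG, ?_⟩
  have hd : ∀ᶠ z in 𝓝 ((0, 0) : 𝕜 × 𝕜), H (z.2, z.2) = 0 :=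
    (continuous_snd.tendsto ((0, 0) : 𝕜 × 𝕜)).eventually hdiag
  filter_upwards [hHG, hd] with z hz hz'
  have hz : H z - H (z.2, z.2) = (z.1 - z.2) * G z := hz
  rw [← hz, hz', sub_zero]

/-- The difference quotient of an analytic function is analytic in both variables. -/
theorem exists_analyticAt_sub_eq_sub_mul [CompleteSpace 𝕜] {φ : 𝕜 → 𝕜} (hφ : AnalyticAt 𝕜 φ 0) :
    ∃ u : 𝕜 × 𝕜 → 𝕜, AnalyticAt 𝕜 u (0, 0) ∧ (∀ᶠ t in 𝓝 (0 : 𝕜), u (t, t) = deriv φ t) ∧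
      ∀ᶠ z in 𝓝 ((0, 0) : 𝕜 × 𝕜), φ z.1 - φ z.2 = (z.1 - z.2) * u z := by
  have hH : AnalyticAt 𝕜 (fun z : 𝕜 × 𝕜 => φ z.1 - φ z.2) (0, 0) :=
    (AnalyticAt.fun_comp (x := ((0, 0) : 𝕜 × 𝕜)) hφ analyticAt_fst).sub
      (AnalyticAt.fun_comp (x := ((0, 0) : 𝕜 × 𝕜)) hφ analyticAt_snd)
  obtain ⟨u, hu, hueq⟩ := exists_analyticAt_eq_sub_mul hH (by simp)
  refine ⟨u, hu, ?_, hueq⟩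
  have hdiag : Tendsto (fun t : 𝕜 => (t, t)) (𝓝 0) (𝓝 ((0, 0) : 𝕜 × 𝕜)) :=
    (Continuous.tendsto (by fun_prop) 0)
  filter_upwards [hdiag.eventually hu.eventually_analyticAt,
    hdiag.eventually hueq.eventually_nhds] with t hut ht
  have hline : Tendsto (fun w : 𝕜 => (w, t)) (𝓝 t) (𝓝 (t, t)) :=
    (Continuous.tendsto (by fun_prop) t)
  -- The slope of `φ` between `w` and `t` is `u (w, t)`, which tends to `u (t, t)`.
  have hd : HasDerivAt φ (u (t, t)) t := by
    rw [hasDerivAt_iff_tendsto_slope]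
    refine ((hut.continuousAt.tendsto.comp hline).mono_left nhdsWithin_le_nhds).congr' ?_
    filter_upwards [(hline.eventually ht).filter_mono nhdsWithin_le_nhds, self_mem_nhdsWithin]
      with w hw hwt
    have hwt : w - t ≠ 0 := sub_ne_zero.2 hwt
    simp only [slope_def_field, Function.comp]
    rw [hw]; field_simp
  exact hd.deriv.symm

/-- A quotient `a(t, s) / (φ(t) - φ(s))` with `a(t, t) = φ'(t)` has principal part `1 / (t - s)`. -/
theorem exists_analyticAt_div_sub_eq [CompleteSpace 𝕜] {φ : 𝕜 → 𝕜} (hφ : AnalyticAt 𝕜 φ 0)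
    (hφ' : deriv φ 0 ≠ 0) {a : 𝕜 × 𝕜 → 𝕜} (ha : AnalyticAt 𝕜 a (0, 0))
    (hdiag : ∀ᶠ t in 𝓝 (0 : 𝕜), a (t, t) = deriv φ t) :
    ∃ A : 𝕜 × 𝕜 → 𝕜, AnalyticAt 𝕜 A (0, 0) ∧ ∀ᶠ z in 𝓝 ((0, 0) : 𝕜 × 𝕜), z.1 ≠ z.2 →
      a z / (φ z.1 - φ z.2) = 1 / (z.1 - z.2) + A z := by
  obtain ⟨u, hu, hud, hueq⟩ := exists_analyticAt_sub_eq_sub_mul hφ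
  have hu0 : u (0, 0) ≠ 0 := by rw [hud.self_of_nhds]; exact hφ'
  obtain ⟨G, hG, hGeq⟩ := exists_analyticAt_eq_sub_mul (ha.sub hu) (by
    filter_upwards [hdiag, hud] with t h1 h2
    simp [h1, h2])
  -- Here `a = u + (t - s) G` and the denominator is `(t - s) u`.
  refine ⟨fun z => G z / u z, hG.div hu hu0, ?_⟩
  filter_upwards [hueq, hGeq, hu.continuousAt.eventually_ne hu0] with z h1 h2 h3 h4
  have h4 : z.1 - z.2 ≠ 0 := sub_ne_zero.2 h4
  have h2 : a z - u z = (z.1 - z.2) * G z := h2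
  rw [h1, div_add_div _ _ h4 h3, div_eq_div_iff (mul_ne_zero h4 h3) (mul_ne_zero h4 h3)]
  linear_combination (z.1 - z.2) * u z * h2

end Hadamard

/-! ### Divided differences of polynomials and the numerators `Nᵐ`. -/

/-- The difference quotient of a polynomial in the `k`-th coordinate is holomorphic, and its value
on the diagonal is the partial derivative. -/
theorem exists_divDiff (k : Fin 3) (F : Poly) :
    ∃ D : Pt × ℂ → ℂ, (∀ z, AnalyticAt ℂ D z) ∧
      (∀ x t, MvPolynomial.eval x F - MvPolynomial.eval (Function.update x k t) F =
        (x k - t) * D (x, t)) ∧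
      ∀ x, D (x, x k) = MvPolynomial.eval x (MvPolynomial.pderiv k F) := by
  have hcoord : ∀ j : Fin 3, ∀ z : Pt × ℂ, AnalyticAt ℂ (fun z : Pt × ℂ => z.1 j) z := fun j z =>
    ((ContinuousLinearMap.proj (R := ℂ) (φ := fun _ : Fin 3 => ℂ) j).comp
      (ContinuousLinearMap.fst ℂ Pt ℂ)).analyticAt z
  induction F using MvPolynomial.induction_on with
  | C a => exact ⟨fun _ => 0, fun _ => analyticAt_const, by simp, by simp⟩
  | add p q hp hq =>
    obtain ⟨D, hD, hDe, hDd⟩ := hp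
    obtain ⟨D', hD', hDe', hDd'⟩ := hq
    refine ⟨fun z => D z + D' z, fun z => (hD z).add (hD' z), fun x t => ?_, fun x => ?_⟩
    · simp only [map_add]; linear_combination hDe x t + hDe' x t
    · simp [hDd, hDd']
  | mul_X p j hp =>
    obtain ⟨D, hD, hDe, hDd⟩ := hp
    by_cases hjk : j = k
    · subst hjk
      -- With `x'` the updated point, `xₖ p(x) - t p(x') = (xₖ - t) p(x) + t (p(x) - p(x'))`.
      refine ⟨fun z => D z * z.2 + MvPolynomial.eval z.1 p,
        fun z => ((hD z).mul analyticAt_snd).add ?_, fun x t => ?_, fun x => ?_⟩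
      · exact (AnalyticOnNhd.eval_mvPolynomial p _ (Set.mem_univ _)).fun_comp analyticAt_fst
      · simp only [map_mul, MvPolynomial.eval_X, Function.update_self]
        linear_combination t * hDe x t
      · simp [hDd, Derivation.leibniz]; ring
    · refine ⟨fun z => D z * z.1 j, fun z => (hD z).mul (hcoord j z), fun x t => ?_, fun x => ?_⟩
      · simp only [map_mul, MvPolynomial.eval_X, Function.update_of_ne hjk]
        linear_combination x j * hDe x t
      · simp [hDd, Derivation.leibniz, MvPolynomial.pderiv_X_of_ne hjk]; ring

theorem analyticAt_update {E : Type*} [NormedAddCommGroup E] [NormedSpace ℂ E] {u : E → Pt}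
    {v : E → ℂ} {z : E} (hu : AnalyticAt ℂ u z) (hv : AnalyticAt ℂ v z) (j : Fin 3) :
    AnalyticAt ℂ (fun z => Function.update (u z) j (v z)) z := by
  rw [analyticAt_pi_iff] at hu ⊢
  intro i
  by_cases h : i = j
  · subst h; simpa using hv
  · simpa [Function.update_of_ne h] using hu i

/-- The path from `x` to `y` that changes the coordinates in the order `j, k, l`: the `2 × 2`
determinant of the values of `(f, g)` at its two inner vertices is divisible, for `x` and `y` on
the curve, by the product of any two of the coordinate differences. -/
theorem exists_det_path_mul_sub_eq (f g : Poly) {j k l : Fin 3} (hkj : k ≠ j) (hlj : l ≠ j)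
    (hlk : l ≠ k) (huniv : ∀ i, i = j ∨ i = k ∨ i = l) (i a b : Fin 3)
    (hab : (i = j ∧ a = l ∧ b = k) ∨ (i = k ∧ a = j ∧ b = l) ∨ (i = l ∧ a = k ∧ b = j)) :
    ∃ H : Pt × Pt → ℂ, (∀ z, AnalyticAt ℂ H z) ∧
      (∀ x, H (x, x) = grad f x a * grad g x b - grad f x b * grad g x a) ∧
      ∀ x ∈ curve f g, ∀ y ∈ curve f g, ∀ w w' : Pt, w = Function.update x j (y j) →
        w' = Function.update w k (y k) →
        (MvPolynomial.eval w' f * MvPolynomial.eval w g -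
          MvPolynomial.eval w f * MvPolynomial.eval w' g) * (x i - y i) =
        (x j - y j) * (x k - y k) * (x l - y l) * H (x, y) := by
  choose D hD hDe hDd using exists_divDiff
  have hfst : ∀ z : Pt × Pt, AnalyticAt ℂ (fun z : Pt × Pt => z.1) z := fun z => analyticAt_fst
  have hsnd : ∀ (n : Fin 3) (z : Pt × Pt), AnalyticAt ℂ (fun z : Pt × Pt => z.2 n) z :=
    fun n z => analyticAt_pi_iff.1 (analyticAt_snd (p := z)) n
  let W : Pt × Pt → Pt := fun z => Function.update z.1 j (z.2 j)
  let W' : Pt × Pt → Pt := fun z => Function.update (W z) k (z.2 k)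
  have hW : ∀ z, AnalyticAt ℂ W z := fun z => analyticAt_update (hfst z) (hsnd j z) j
  have hW' : ∀ z, AnalyticAt ℂ W' z := fun z => analyticAt_update (hW z) (hsnd k z) k
  -- Each divided difference is based at the vertex from which its coordinate changes. On the
  -- diagonal all vertices coincide, so `Q` becomes the gradient.
  let Q : Fin 3 → Poly → Pt × Pt → ℂ := fun n F z =>
    if n = j then D n F (z.1, z.2 n) else if n = k then D n F (W z, z.2 n) else D n F (W' z, z.2 n)
  have hQ : ∀ n F z, AnalyticAt ℂ (Q n F) z := by
    intro n F z
    simp only [Q]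
    split_ifs
    · exact (hD n F _).fun_comp ((hfst z).prod (hsnd n z))
    · exact (hD n F _).fun_comp ((hW z).prod (hsnd n z))
    · exact (hD n F _).fun_comp ((hW' z).prod (hsnd n z))
  have hQd : ∀ n F x, Q n F (x, x) = grad F x n := by
    intro n F x
    simp [Q, W', W, hDd, grad]
  refine ⟨fun z => Q a f z * Q b g z - Q b f z * Q a g z, fun z =>
    ((hQ _ _ z).mul (hQ _ _ z)).sub ((hQ _ _ z).mul (hQ _ _ z)), fun x => by simp [hQd], ?_⟩
  rintro x ⟨hfx, hgx⟩ y ⟨hfy, hgy⟩ w w' hw hw'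
  have hy : Function.update w' l (y l) = y := by
    ext n
    rcases huniv n with rfl | rfl | rfl
    · simp [hw', hw, hlj.symm, hkj.symm]
    · simp [hw', hlk.symm]
    · simp
  have e1 : ∀ F, MvPolynomial.eval x F - MvPolynomial.eval w F = (x j - y j) * Q j F (x, y) :=
    fun F => by rw [hw]; simpa [Q] using hDe j F x (y j)
  have e2 : ∀ F, MvPolynomial.eval w F - MvPolynomial.eval w' F = (x k - y k) * Q k F (x, y) :=
    fun F => by
      rw [hw']
      have := hDe k F w (y k)
      simpa [Q, W, hkj, hw] using this
  have e3 : ∀ F, MvPolynomial.eval w' F - MvPolynomial.eval y F = (x l - y l) * Q l F (x, y) :=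
    fun F => by
      have := hDe l F w' (y l)
      rw [hy] at this
      simpa [Q, W', W, hlj, hlk, hw', hw] using this
  have f1 := e1 f
  have f2 := e2 f
  have f3 := e3 f
  have g1 := e1 g
  have g2 := e2 g
  have g3 := e3 g
  rw [hfx, zero_sub] at f1
  rw [hgx, zero_sub] at g1
  rw [hfy, sub_zero] at f3
  rw [hgy, sub_zero] at g3
  -- The vectors of values at `w` and `w'` are `-(xⱼ - yⱼ) Qⱼ` and `(xₗ - yₗ) Qₗ`, and they differ
  -- by `(xₖ - yₖ) Qₖ`. Each case uses the two of these that avoid the index `i`.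
  rcases hab with ⟨rfl, rfl, rfl⟩ | ⟨rfl, rfl, rfl⟩ | ⟨rfl, rfl, rfl⟩
  · rw [sub_eq_iff_eq_add.1 f2, sub_eq_iff_eq_add.1 g2, f3, g3]; ring
  · rw [neg_eq_iff_eq_neg.1 f1, neg_eq_iff_eq_neg.1 g1, f3, g3]; ring
  · rw [← sub_sub_cancel (MvPolynomial.eval w f) (MvPolynomial.eval w' f),
      ← sub_sub_cancel (MvPolynomial.eval w g) (MvPolynomial.eval w' g), f2, g2,
      neg_eq_iff_eq_neg.1 f1, neg_eq_iff_eq_neg.1 g1]; ring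

/-- On the curve, `Nᵐ(x, y) / ((x₁ - y₁)(x₂ - y₂)(x₃ - y₃))` is, for each `i`, the quotient of a
holomorphic function with the value `Jⁱ` on the diagonal by `xᵢ - yᵢ`. -/
theorem exists_N_mul_sub_eq (f g : Poly) (m i : Fin 3) :
    ∃ H : Pt × Pt → ℂ, (∀ z, AnalyticAt ℂ H z) ∧ (∀ x, H (x, x) = J f g i x) ∧
      ∀ x ∈ curve f g, ∀ y ∈ curve f g,
        N f g m x y * (x i - y i) = diffProd x y * H (x, y) := by
  have hlt : ∀ i : Fin 3, i = 0 ∨ i = 1 ∨ i = 2 := by decide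
  have hJ : ∀ x, J f g i x = grad f x (i + 1) * grad g x (i + 2) -
      grad f x (i + 2) * grad g x (i + 1) := by
    intro x
    rcases hlt i with rfl | rfl | rfl <;> simp [J, cross_apply]
  obtain ⟨H, hH, hd, he⟩ := exists_det_path_mul_sub_eq f g (j := m + 1) (k := m) (l := m + 2)
    (by revert m; decide) (by revert m; decide) (by revert m; decide) (by revert m; decide)
    i (i + 1) (i + 2) (by clear hJ; revert m i; decide)
  refine ⟨H, hH, fun x => by rw [hd, hJ], fun x hx y hy => ?_⟩
  have hprod : (x (m + 1) - y (m + 1)) * (x m - y m) * (x (m + 2) - y (m + 2)) = diffProd x y := by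
    rcases hlt m with rfl | rfl | rfl
    · change (x 1 - y 1) * (x 0 - y 0) * (x 2 - y 2) = _; rw [diffProd]; ring
    · change (x 2 - y 2) * (x 1 - y 1) * (x 0 - y 0) = _; rw [diffProd]; ring
    · change (x 0 - y 0) * (x 2 - y 2) * (x 1 - y 1) = _; rw [diffProd]; ring
  rw [← hprod, ← he x hx y hy _ _ rfl rfl]
  congr 1
  rcases hlt m with rfl | rfl | rfl
  · have h1 : Function.update x (0 + 1) (y (0 + 1)) = ![x 0, y 1, x 2] := by
      ext n; fin_cases n <;> simp
    have h2 : Function.update ![x 0, y 1, x 2] 0 (y 0) = ![y 0, y 1, x 2] := by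
      ext n; fin_cases n <;> simp
    simp only [h1, h2]; simp [N]
  · have h1 : Function.update x (1 + 1) (y (1 + 1)) = ![x 0, x 1, y 2] := by
      ext n; fin_cases n <;> simp
    have h2 : Function.update ![x 0, x 1, y 2] 1 (y 1) = ![x 0, y 1, y 2] := by
      ext n; fin_cases n <;> simp
    simp only [h1, h2]; simp [N]
  · have h1 : Function.update x (2 + 1) (y (2 + 1)) = ![y 0, x 1, x 2] := by
      ext n; fin_cases n <;> simp
    have h2 : Function.update ![y 0, x 1, x 2] 2 (y 2) = ![y 0, x 1, y 2] := by
      ext n; fin_cases n <;> simp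
    simp only [h1, h2]; simp [N]

/-! ### Tangent vectors and local parametrizations. -/

theorem hasStrictFDerivAt_eval (F : Poly) (x : Pt) :
    HasStrictFDerivAt (fun x : Pt => MvPolynomial.eval x F) (∑ k, grad F x k • dx k) x := by
  induction F using MvPolynomial.induction_on with
  | C a =>
    simp only [MvPolynomial.eval_C]
    refine (hasStrictFDerivAt_const (𝕜 := ℂ) (E := Pt) (F := ℂ) a x).congr_fderiv ?_
    ext v
    simp [grad]
  | add p q hp hq =>
    simp only [map_add]
    refine (hp.fun_add hq).congr_fderiv ?_
    rw [← Finset.sum_add_distrib]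
    exact Finset.sum_congr rfl fun k _ => by ext v; simp [grad, add_mul]
  | mul_X p j hp =>
    have hX : HasStrictFDerivAt (fun x : Pt => x j) (dx j) x := (dx j).hasStrictFDerivAt
    have h : ∀ k, grad (p * MvPolynomial.X j) x k =
        (if k = j then MvPolynomial.eval x p else 0) + x j * grad p x k := by
      intro k
      by_cases hk : j = k
      · subst hk; simp [grad, Derivation.leibniz]
      · simp [grad, Derivation.leibniz, MvPolynomial.pderiv_X_of_ne hk, Ne.symm hk]
    simp only [map_mul, MvPolynomial.eval_X]
    refine (hp.fun_mul hX).congr_fderiv ?_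
    ext v
    simp [h, add_mul, Finset.sum_add_distrib, Finset.mul_sum, dx, mul_assoc]

theorem exists_J_ne_zero {f g : Poly} (hreg : IsRegular f g) {p : Pt} (hp : p ∈ curve f g) :
    ∃ i, J f g i p ≠ 0 := by
  have h := hreg p hp
  rw [Matrix.rank_eq_finrank_span_row] at h
  have hli : LinearIndependent ℂ ![grad f p, grad g p] := by
    rw [linearIndependent_iff_card_eq_finrank_span, Fintype.card_fin]
    exact h.symm
  exact Function.ne_iff.1 (crossProduct_ne_zero_iff_linearIndependent.2 hli)

/-- A vector that is orthogonal to both gradients is proportional to `(J¹, J², J³)`. -/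
theorem mul_J_eq_of_sum_eq_zero {f g : Poly} {x v : Pt} (hf : ∑ k, grad f x k * v k = 0)
    (hg : ∑ k, grad g x k * v k = 0) (i j : Fin 3) : v i * J f g j x = v j * J f g i x := by
  rw [Fin.sum_univ_three] at hf hg
  have h01 : v 0 * J f g 1 x = v 1 * J f g 0 x := by
    simp only [J, cross_apply, Matrix.cons_val]
    linear_combination grad f x 2 * hg - grad g x 2 * hf
  have h02 : v 0 * J f g 2 x = v 2 * J f g 0 x := by
    simp only [J, cross_apply, Matrix.cons_val]
    linear_combination -grad f x 1 * hg + grad g x 1 * hf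
  have h12 : v 1 * J f g 2 x = v 2 * J f g 1 x := by
    simp only [J, cross_apply, Matrix.cons_val]
    linear_combination grad f x 0 * hg - grad g x 0 * hf
  fin_cases i <;> fin_cases j <;> simp [h01, h02, h12]

theorem analyticAt_J (f g : Poly) (i : Fin 3) (x : Pt) : AnalyticAt ℂ (J f g i) x := by
  have h : ∀ (F : Poly) (k : Fin 3), AnalyticAt ℂ (fun x => grad F x k) x := fun F k =>
    AnalyticOnNhd.eval_mvPolynomial _ x (Set.mem_univ x)
  have hJ : J f g i = fun x => ![grad f x 1 * grad g x 2 - grad f x 2 * grad g x 1,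
      grad f x 2 * grad g x 0 - grad f x 0 * grad g x 2,
      grad f x 0 * grad g x 1 - grad f x 1 * grad g x 0] i := by
    ext x; rw [J, cross_apply]
  rw [hJ]
  fin_cases i <;> exact ((h _ _).mul (h _ _)).sub ((h _ _).mul (h _ _))

/-- The tangent vector of an analytic arc in the curve is an analytic multiple of `J`. -/
theorem exists_deriv_eq_mul_J {f g : Poly} (hreg : IsRegular f g) {γ : ℂ → Pt} {p : Pt}
    (hp : p ∈ curve f g) (hγ : AnalyticAt ℂ γ 0) (h0 : γ 0 = p)
    (hmem : ∀ᶠ t in 𝓝 (0 : ℂ), γ t ∈ curve f g) :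
    ∃ c : ℂ → ℂ, AnalyticAt ℂ c 0 ∧ ∀ᶠ t in 𝓝 (0 : ℂ), ∀ i, deriv γ t i = c t * J f g i (γ t) := by
  subst h0
  obtain ⟨j, hj⟩ := exists_J_ne_zero hreg hp
  have hJ : AnalyticAt ℂ (fun t => J f g j (γ t)) 0 := (analyticAt_J f g j _).fun_comp hγ
  -- One index `j` with `Jʲ(p) ≠ 0` defines `c`; proportionality of the tangent to `J` gives the
  -- other coordinates, even where their `Jⁱ` vanish.
  refine ⟨fun t => deriv γ t j / J f g j (γ t), (analyticAt_pi_iff.1 hγ.deriv j).div hJ hj, ?_⟩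
  filter_upwards [hmem.eventually_nhds, hγ.eventually_analyticAt, hJ.continuousAt.eventually_ne hj]
    with t ht hγt hjt i
  have horth : ∀ F : Poly, (∀ᶠ s in 𝓝 t, MvPolynomial.eval (γ s) F = 0) →
      ∑ k, grad F (γ t) k * deriv γ t k = 0 := by
    intro F hF
    have h1 := (hasStrictFDerivAt_eval F (γ t)).hasFDerivAt.comp_hasDerivAt t
      hγt.differentiableAt.hasDerivAt
    have h2 : HasDerivAt (fun s => MvPolynomial.eval (γ s) F) 0 t :=
      (hasDerivAt_const t (0 : ℂ)).congr_of_eventuallyEq hF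
    simpa [dx] using h1.unique h2
  have := mul_J_eq_of_sum_eq_zero (horth f (ht.mono fun s hs => hs.1))
    (horth g (ht.mono fun s hs => hs.2)) i j
  rw [div_mul_eq_mul_div, eq_div_iff hjt, this]

/-- The implicit function theorem for the curve. -/
theorem exists_isLocalParam {f g : Poly} (hreg : IsRegular f g) {p : Pt} (hp : p ∈ curve f g) :
    ∃ γ : ℂ → Pt, IsLocalParam f g γ p ∧ map γ (𝓝 0) = 𝓝[curve f g] p := by
  obtain ⟨i, hi⟩ := exists_J_ne_zero hreg hp
  -- When `Jⁱ(p) ≠ 0`, these are local coordinates that straighten the curve to the third axis.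
  let Φ : Pt → Pt := fun x => ![MvPolynomial.eval x f, MvPolynomial.eval x g, x i]
  let L : Pt →L[ℂ] Pt := ContinuousLinearMap.pi
    ![∑ k, grad f p k • dx k, ∑ k, grad g p k • dx k, dx i]
  have hΦan : AnalyticAt ℂ Φ p := by
    rw [analyticAt_pi_iff]
    intro n
    fin_cases n
    · exact AnalyticOnNhd.eval_mvPolynomial f p (Set.mem_univ p)
    · exact AnalyticOnNhd.eval_mvPolynomial g p (Set.mem_univ p)
    · exact (dx i).analyticAt p
  have hΦ : HasStrictFDerivAt Φ L p := by
    rw [hasStrictFDerivAt_pi']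
    intro n
    fin_cases n
    · exact hasStrictFDerivAt_eval f p
    · exact hasStrictFDerivAt_eval g p
    · exact (dx i).hasStrictFDerivAt
  have hinj : Function.Injective L := by
    rw [injective_iff_map_eq_zero]
    intro v hv
    have h0 : ∑ k, grad f p k * v k = 0 := by simpa [L, dx] using congrFun hv 0
    have h1 : ∑ k, grad g p k * v k = 0 := by simpa [L, dx] using congrFun hv 1
    have h2 : v i = 0 := by simpa [L, dx] using congrFun hv 2
    ext j
    have := mul_J_eq_of_sum_eq_zero h0 h1 j i
    rw [h2, zero_mul] at this
    exact (mul_eq_zero.1 this).resolve_right hi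
  let e : Pt ≃L[ℂ] Pt := (LinearEquiv.ofInjectiveEndo (L : Pt →ₗ[ℂ] Pt) hinj).toContinuousLinearEquiv
  have he : (e : Pt →L[ℂ] Pt) = L := by ext v : 1; rfl
  have hΦe : HasStrictFDerivAt Φ (e : Pt →L[ℂ] Pt) p := by rw [he]; exact hΦ
  let Ψ : Pt → Pt := hΦe.localInverse Φ e p
  have hΨp : Ψ (Φ p) = p := hΦe.localInverse_apply_image
  have hΨp' : (hΦe.toOpenPartialHomeomorph Φ).symm (Φ p) = p := hΨp
  have hΨan : AnalyticAt ℂ Ψ (Φ p) :=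
    -- The smoothness exponent `⊤` is the analytic class.
    ((hΦe.toOpenPartialHomeomorph Φ).contDiffAt_symm (n := ⊤)
      hΦe.image_mem_toOpenPartialHomeomorph_target
      (by rw [HasStrictFDerivAt.toOpenPartialHomeomorph_coe, hΨp']; exact hΦe.hasFDerivAt)
      (by rw [HasStrictFDerivAt.toOpenPartialHomeomorph_coe, hΨp']; exact
        hΦan.contDiffAt)).analyticAt
  let ι : ℂ → Pt := fun t => ![0, 0, p i + t]
  have hι : AnalyticAt ℂ ι 0 := by
    rw [analyticAt_pi_iff]
    intro n
    fin_cases n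
    · exact analyticAt_const
    · exact analyticAt_const
    · exact analyticAt_const.add analyticAt_id
  have hι0 : ι 0 = Φ p := by
    simp [ι, Φ, hp.1, hp.2]
  have hγan : AnalyticAt ℂ (fun t => Ψ (ι t)) 0 := by
    rw [← hι0] at hΨan
    exact hΨan.fun_comp hι
  have hright : ∀ᶠ t in 𝓝 (0 : ℂ), Φ (Ψ (ι t)) = ι t := by
    have := hΦe.eventually_right_inverse
    rw [← hι0] at this
    exact hι.continuousAt.eventually this
  have hmem : ∀ᶠ t in 𝓝 (0 : ℂ), Ψ (ι t) ∈ curve f g := hright.mono fun t ht =>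
    ⟨congrFun ht 0, congrFun ht 1⟩
  have hγ0 : Ψ (ι 0) = p := by rw [hι0, hΨp]
  refine ⟨fun t => Ψ (ι t), ⟨hγan, hγ0, fun h => ?_, hmem⟩, le_antisymm ?_ ?_⟩
  · have h1 : HasDerivAt (fun t => Ψ (ι t) i) 0 0 := by
      have := hasDerivAt_pi.1 hγan.differentiableAt.hasDerivAt i
      rwa [h] at this
    have h2 : HasDerivAt (fun t => Ψ (ι t) i) 1 0 := by
      refine ((hasDerivAt_id (0 : ℂ)).const_add (p i)).congr_of_eventuallyEq ?_
      exact hright.mono fun t ht => congrFun ht 2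
    exact zero_ne_one (h1.unique h2)
  · refine tendsto_nhdsWithin_iff.2 ⟨?_, hmem⟩
    have := hγan.continuousAt.tendsto
    rwa [hγ0] at this
  · have hcoord : Tendsto (fun x : Pt => x i - p i) (𝓝[curve f g] p) (𝓝 0) := by
      have : Tendsto (fun x : Pt => x i - p i) (𝓝 p) (𝓝 (p i - p i)) :=
        Continuous.tendsto (by fun_prop) p
      rw [sub_self] at this
      exact this.mono_left nhdsWithin_le_nhds
    -- On the curve `xᵢ - pᵢ` is an inverse of the parametrization; this makes the image of the
    -- neighbourhoods of `0` fill those of `p` in the curve.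
    have hleft : ∀ᶠ x in 𝓝[curve f g] p, Ψ (ι (x i - p i)) = x := by
      filter_upwards [self_mem_nhdsWithin,
        hΦe.eventually_left_inverse.filter_mono nhdsWithin_le_nhds] with x hx hinv
      have : ι (x i - p i) = Φ x := by simp [ι, Φ, hx.1, hx.2]
      rw [this]
      exact hinv
    calc 𝓝[curve f g] p = map (fun x => Ψ (ι (x i - p i))) (𝓝[curve f g] p) := by
          rw [map_congr hleft, map_id']
      _ = map (fun t => Ψ (ι t)) (map (fun x : Pt => x i - p i) (𝓝[curve f g] p)) := by
          rw [map_map]; rfl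
      _ ≤ map (fun t => Ψ (ι t)) (𝓝 0) := map_mono hcoord

/-! ### Poles of the weighted kernels. -/

/-- The weighted mean of the kernels `Nⁱ/Jⁱ · dxᵢ / ((x₁ - y₁)(x₂ - y₂)(x₃ - y₃))`. -/
noncomputable def weightedKernel (f g : Poly) (w : Fin 3 → ℂ) (x y : Pt) : Pt →L[ℂ] ℂ :=
  ∑ i, (w i * (N f g i x y / J f g i x / diffProd x y)) • dx i

theorem K_eq_weightedKernel (f g : Poly) : K f g = weightedKernel f g ![1, 0, 0] := by
  ext x y v
  simp [K, weightedKernel, Fin.sum_univ_three]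

theorem Ksym_eq_weightedKernel (f g : Poly) :
    Ksym f g = weightedKernel f g fun _ => 1 / 3 := by
  ext x y v
  simp [Ksym, weightedKernel, Finset.mul_sum, mul_assoc]

theorem isClosed_curve (f g : Poly) : IsClosed (curve f g) :=
  (isClosed_eq (MvPolynomial.continuous_eval f) continuous_const).inter
    (isClosed_eq (MvPolynomial.continuous_eval g) continuous_const)

/-- Along analytic arcs of the curve the kernel is, for each `i`, the quotient of an analytic
function by `xᵢ - yᵢ`. -/
theorem exists_weightedKernel_eq_div {f g : Poly} (hreg : IsRegular f g) {w : Fin 3 → ℂ}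
    (hw : ∑ i, w i = 1) {γ δ : ℂ → Pt} {p : Pt} (hp : p ∈ curve f g) (hγ : AnalyticAt ℂ γ 0)
    (h0 : γ 0 = p) (hγm : ∀ᶠ t in 𝓝 (0 : ℂ), γ t ∈ curve f g) (hδ : AnalyticAt ℂ δ 0)
    (hδm : ∀ᶠ t in 𝓝 (0 : ℂ), δ t ∈ curve f g) (i : Fin 3) :
    ∃ a : ℂ × ℂ → ℂ, AnalyticAt ℂ a (0, 0) ∧
      (∀ᶠ z in 𝓝 ((0, 0) : ℂ × ℂ), (∀ j, w j ≠ 0 → J f g j (γ z.1) ≠ 0) →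
        (∀ j, γ z.1 j ≠ δ z.2 j) →
        weightedKernel f g w (γ z.1) (δ z.2) (deriv γ z.1) = a z / (γ z.1 i - δ z.2 i)) ∧
      (δ = γ → ∀ᶠ t in 𝓝 (0 : ℂ), a (t, t) = deriv γ t i) := by
  obtain ⟨c, hc, hcJ⟩ := exists_deriv_eq_mul_J hreg hp hγ h0 hγm
  choose H hH hHd hHN using fun m => exists_N_mul_sub_eq f g m i
  -- The factor `c` stands for `dxₘ / Jᵐ`, and `H m` for `Nᵐ (xᵢ - yᵢ) / ∏ (xₙ - yₙ)`.
  refine ⟨fun z => c z.1 * ∑ m, w m * H m (γ z.1, δ z.2), ?_, ?_, ?_⟩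
  · have hpair : AnalyticAt ℂ (fun z : ℂ × ℂ => (γ z.1, δ z.2)) (0, 0) :=
      (AnalyticAt.fun_comp (x := ((0, 0) : ℂ × ℂ)) hγ analyticAt_fst).prod
        (AnalyticAt.fun_comp (x := ((0, 0) : ℂ × ℂ)) hδ analyticAt_snd)
    exact (AnalyticAt.fun_comp (x := ((0, 0) : ℂ × ℂ)) hc analyticAt_fst).mul
      (Finset.analyticAt_fun_sum _ fun m _ =>
        analyticAt_const.mul ((hH m _).fun_comp hpair))
  · have hfst : Tendsto Prod.fst (𝓝 ((0, 0) : ℂ × ℂ)) (𝓝 0) := continuous_fst.tendsto _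
    have hsnd : Tendsto Prod.snd (𝓝 ((0, 0) : ℂ × ℂ)) (𝓝 0) := continuous_snd.tendsto _
    filter_upwards [hfst.eventually hcJ, hfst.eventually hγm, hsnd.eventually hδm]
      with z hz hx hy hJ hne
    have hi : γ z.1 i - δ z.2 i ≠ 0 := sub_ne_zero.2 (hne i)
    have hP : diffProd (γ z.1) (δ z.2) ≠ 0 :=
      mul_ne_zero (mul_ne_zero (sub_ne_zero.2 (hne 0)) (sub_ne_zero.2 (hne 1)))
        (sub_ne_zero.2 (hne 2))
    simp only [weightedKernel, dx, _root_.sum_apply, _root_.smul_apply,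
      ContinuousLinearMap.proj_apply, smul_eq_mul, Finset.mul_sum, Finset.sum_div]
    refine Finset.sum_congr rfl fun m _ => ?_
    -- A term of weight zero drops out even where its `Jᵐ` vanishes, since division by zero has a
    -- value.
    by_cases hm : w m = 0
    · simp [hm]
    have hJm := hJ m hm
    have hN : N f g m (γ z.1) (δ z.2) / diffProd (γ z.1) (δ z.2) =
        H m (γ z.1, δ z.2) / (γ z.1 i - δ z.2 i) := by
      rw [div_eq_div_iff hP hi, hHN m _ hx _ hy, mul_comm]
    rw [hz m, div_right_comm, hN]
    field_simp
  · rintro rfl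
    filter_upwards [hcJ] with t ht
    -- All `H m` equal `Jⁱ` on the diagonal, so total weight one leaves `c Jⁱ = γᵢ'`.
    simp only [hHd, ← Finset.sum_mul, hw, one_mul, ht i]

theorem deriv_apply_coord {γ : ℂ → Pt} {t : ℂ} (h : DifferentiableAt ℂ γ t) (i : Fin 3) :
    deriv (fun s => γ s i) t = deriv γ t i :=
  (hasDerivAt_pi.1 h.hasDerivAt i).deriv

/-- At a pair of distinct points the kernel has no pole. -/
theorem exists_analyticAt_weightedKernel_eq {f g : Poly} (hreg : IsRegular f g) {w : Fin 3 → ℂ}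
    (hw : ∑ i, w i = 1) {γ δ : ℂ → Pt} (hγ : AnalyticAt ℂ γ 0)
    (hγm : ∀ᶠ t in 𝓝 (0 : ℂ), γ t ∈ curve f g) (hδ : AnalyticAt ℂ δ 0)
    (hδm : ∀ᶠ t in 𝓝 (0 : ℂ), δ t ∈ curve f g) (hne : γ 0 ≠ δ 0) :
    ∃ A : ℂ × ℂ → ℂ, AnalyticAt ℂ A (0, 0) ∧
      ∀ᶠ z in 𝓝 ((0, 0) : ℂ × ℂ), (∀ j, w j ≠ 0 → J f g j (γ z.1) ≠ 0) →
        (∀ j, γ z.1 j ≠ δ z.2 j) →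
        weightedKernel f g w (γ z.1) (δ z.2) (deriv γ z.1) = A z := by
  obtain ⟨i, hi⟩ := Function.ne_iff.1 hne
  obtain ⟨a, ha, hae, -⟩ :=
    exists_weightedKernel_eq_div hreg hw hγm.self_of_nhds hγ rfl hγm hδ hδm i
  refine ⟨_, ha.div ?_ (sub_ne_zero.2 hi), hae⟩
  exact (AnalyticAt.fun_comp (x := ((0, 0) : ℂ × ℂ)) (analyticAt_pi_iff.1 hγ i) analyticAt_fst).sub
    (AnalyticAt.fun_comp (x := ((0, 0) : ℂ × ℂ)) (analyticAt_pi_iff.1 hδ i) analyticAt_snd)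

/-- The kernel has a simple pole with residue one on the diagonal. -/
theorem exists_analyticAt_weightedKernel_eq_add {f g : Poly} (hreg : IsRegular f g)
    {w : Fin 3 → ℂ} (hw : ∑ i, w i = 1) {γ : ℂ → Pt} {p : Pt} (hp : p ∈ curve f g)
    (hγ : IsLocalParam f g γ p) :
    ∃ A : ℂ × ℂ → ℂ, AnalyticAt ℂ A (0, 0) ∧
      ∀ᶠ z in 𝓝 ((0, 0) : ℂ × ℂ), (∀ j, w j ≠ 0 → J f g j (γ z.1) ≠ 0) →
        (∀ j, γ z.1 j ≠ γ z.2 j) →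
        weightedKernel f g w (γ z.1) (γ z.2) (deriv γ z.1) = 1 / (z.1 - z.2) + A z := by
  -- This `i` need not carry any weight: the form `a / (xᵢ - yᵢ)` is available for every `i`.
  obtain ⟨i, hi⟩ := Function.ne_iff.1 hγ.deriv_ne_zero
  obtain ⟨a, ha, hae, had⟩ := exists_weightedKernel_eq_div hreg hw hp hγ.analyticAt hγ.map_zero
    hγ.mem_curve hγ.analyticAt hγ.mem_curve i
  have hd : ∀ᶠ t in 𝓝 (0 : ℂ), deriv (fun s => γ s i) t = deriv γ t i :=
    hγ.analyticAt.eventually_analyticAt.mono fun t ht => deriv_apply_coord ht.differentiableAt i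
  obtain ⟨A, hA, hAe⟩ := exists_analyticAt_div_sub_eq (analyticAt_pi_iff.1 hγ.analyticAt i)
    (by rw [hd.self_of_nhds]; exact hi) ha
    (by filter_upwards [had rfl, hd] with t h1 h2; rw [h1, h2])
  refine ⟨A, hA, ?_⟩
  filter_upwards [hae, hAe] with z h1 h2 hJ hne
  rw [h1 hJ hne, h2 fun h => hne i (by rw [h])]

/-- Where `xᵢ` is a local coordinate, `dxᵢ / (xᵢ - yᵢ)` has a simple pole with residue one on the
diagonal. -/
theorem exists_analyticAt_dx_div_eq_add {f g : Poly} (hreg : IsRegular f g) {γ : ℂ → Pt} {p : Pt}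
    (hp : p ∈ curve f g) (hγ : IsLocalParam f g γ p) {i : Fin 3} (hi : J f g i p ≠ 0) :
    ∃ A : ℂ × ℂ → ℂ, AnalyticAt ℂ A (0, 0) ∧
      ∀ᶠ z in 𝓝 ((0, 0) : ℂ × ℂ), z.1 ≠ z.2 →
        (1 / (γ z.1 i - γ z.2 i)) * dx i (deriv γ z.1) = 1 / (z.1 - z.2) + A z := by
  obtain ⟨c, -, hcJ⟩ := exists_deriv_eq_mul_J hreg hp hγ.analyticAt hγ.map_zero hγ.mem_curve
  have hc := hcJ.self_of_nhds
  have hd : ∀ᶠ t in 𝓝 (0 : ℂ), deriv (fun s => γ s i) t = deriv γ t i :=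
    hγ.analyticAt.eventually_analyticAt.mono fun t ht => deriv_apply_coord ht.differentiableAt i
  have hne : deriv γ 0 i ≠ 0 := by
    rw [hc i, hγ.map_zero]
    refine mul_ne_zero (fun h => hγ.deriv_ne_zero ?_) hi
    ext j
    simp [hc j, h]
  obtain ⟨A, hA, hAe⟩ := exists_analyticAt_div_sub_eq (analyticAt_pi_iff.1 hγ.analyticAt i)
    (a := fun z => deriv γ z.1 i) (by rw [hd.self_of_nhds]; exact hne)
    (AnalyticAt.fun_comp (x := ((0, 0) : ℂ × ℂ)) (analyticAt_pi_iff.1 hγ.analyticAt.deriv i)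
      analyticAt_fst)
    (hd.mono fun t ht => ht.symm)
  refine ⟨A, hA, hAe.mono fun z hz hne => ?_⟩
  rw [← hz hne, dx, ContinuousLinearMap.proj_apply, one_div_mul_eq_div]

/-! ### Meromorphy along arcs. -/

theorem meromorphicAt_eval {u : ℂ → Pt} {t₀ : ℂ} (hu : ∀ i, MeromorphicAt (fun t => u t i) t₀)
    (F : Poly) : MeromorphicAt (fun t => MvPolynomial.eval (u t) F) t₀ := by
  induction F using MvPolynomial.induction_on with
  | C a => simp
  | add p q hp hq => simpa using hp.fun_add hq
  | mul_X p j hp => simpa using hp.fun_mul (hu j)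

theorem meromorphicAt_J (f g : Poly) {u : ℂ → Pt} {t₀ : ℂ}
    (hu : ∀ i, MeromorphicAt (fun t => u t i) t₀) (i : Fin 3) :
    MeromorphicAt (fun t => J f g i (u t)) t₀ := by
  have h : ∀ (F : Poly) (k : Fin 3), MeromorphicAt (fun t => grad F (u t) k) t₀ := fun F k =>
    meromorphicAt_eval hu _
  simp only [J, cross_apply]
  fin_cases i <;> exact ((h _ _).mul (h _ _)).sub ((h _ _).mul (h _ _))

theorem meromorphicAt_N (f g : Poly) {u v : ℂ → Pt} {t₀ : ℂ}
    (hu : ∀ i, MeromorphicAt (fun t => u t i) t₀) (hv : ∀ i, MeromorphicAt (fun t => v t i) t₀)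
    (i : Fin 3) : MeromorphicAt (fun t => N f g i (u t) (v t)) t₀ := by
  have h : ∀ (F : Poly) {a b c : ℂ → ℂ}, MeromorphicAt a t₀ → MeromorphicAt b t₀ →
      MeromorphicAt c t₀ → MeromorphicAt (fun t => MvPolynomial.eval ![a t, b t, c t] F) t₀ := by
    intro F a b c ha hb hc
    refine meromorphicAt_eval (u := fun t => ![a t, b t, c t]) (fun j => ?_) F
    fin_cases j
    exacts [ha, hb, hc]
  fin_cases i <;> simp only [N] <;>
    exact ((h _ (by simp [hu, hv]) (by simp [hu, hv]) (by simp [hu, hv])).mul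
      (h _ (by simp [hu, hv]) (by simp [hu, hv]) (by simp [hu, hv]))).sub
      ((h _ (by simp [hu, hv]) (by simp [hu, hv]) (by simp [hu, hv])).mul
      (h _ (by simp [hu, hv]) (by simp [hu, hv]) (by simp [hu, hv])))

theorem meromorphicAt_weightedKernel (f g : Poly) (w : Fin 3 → ℂ) {u v V : ℂ → Pt} {t₀ : ℂ}
    (hu : ∀ i, MeromorphicAt (fun t => u t i) t₀) (hv : ∀ i, MeromorphicAt (fun t => v t i) t₀)
    (hV : ∀ i, MeromorphicAt (fun t => V t i) t₀) :
    MeromorphicAt (fun t => weightedKernel f g w (u t) (v t) (V t)) t₀ := by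
  simp only [weightedKernel, dx, _root_.sum_apply, _root_.smul_apply,
    ContinuousLinearMap.proj_apply, smul_eq_mul, diffProd]
  refine MeromorphicAt.fun_sum fun i _ => ?_
  exact ((MeromorphicAt.const (w i) t₀).fun_mul (((meromorphicAt_N f g hu hv i).fun_div
    (meromorphicAt_J f g hu i)).fun_div ((((hu 0).fun_sub (hv 0)).fun_mul
      ((hu 1).fun_sub (hv 1))).fun_mul ((hu 2).fun_sub (hv 2))))).fun_mul (hV i)

theorem meromorphicAt_deriv_coord {u : ℂ → Pt} {t₀ : ℂ}
    (hu : ∀ i, MeromorphicAt (fun t => u t i) t₀) (i : Fin 3) :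
    MeromorphicAt (fun t => deriv u t i) t₀ := by
  refine (hu i).deriv.congr ?_
  -- Where `u` is not differentiable `deriv u` is zero by default; for `t` near but different from
  -- `t₀` all coordinates are analytic.
  filter_upwards [eventually_all.2 fun j => (hu j).eventually_analyticAt] with t ht
  exact deriv_apply_coord (analyticAt_pi_iff.2 ht).differentiableAt i

/-! ### Zeros of the denominators and extension of arcs. -/

/-- Along a local parametrization, away from its centre, no `Jⁱ` vanishes and no coordinate takes
a prescribed value. -/
theorem IsLocalParam.eventually_J_ne_zero_and_ne {f g : Poly} (hreg : IsRegular f g)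
    (hcoord : CoordsNonconstant f g) {γ : ℂ → Pt} {p : Pt} (hp : p ∈ curve f g)
    (hγ : IsLocalParam f g γ p) (hmap : map γ (𝓝 0) = 𝓝[curve f g] p) (y : Pt) :
    ∀ᶠ t in 𝓝[≠] (0 : ℂ), (∀ i, J f g i (γ t) ≠ 0) ∧ ∀ i, γ t i ≠ y i := by
  have hnc : ∀ (i : Fin 3) (b : ℂ), ¬ ∀ᶠ t in 𝓝 (0 : ℂ), γ t i = b := by
    intro i b h
    have hb : p i = b := by rw [← h.self_of_nhds, hγ.map_zero]
    refine hcoord i p hp ?_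
    rw [← hmap, eventually_map]
    simpa [hb] using h
  have hy : ∀ i, ∀ᶠ t in 𝓝[≠] (0 : ℂ), γ t i ≠ y i := by
    intro i
    rcases ((analyticAt_pi_iff.1 hγ.analyticAt i).sub
      analyticAt_const).eventually_eq_zero_or_eventually_ne_zero (f := fun t => γ t i - y i)
      with h | h
    · exact absurd (h.mono fun t ht => sub_eq_zero.1 ht) (hnc i _)
    · exact h.mono fun t ht => sub_ne_zero.1 ht
  have hJ : ∀ i, ∀ᶠ t in 𝓝[≠] (0 : ℂ), J f g i (γ t) ≠ 0 := by
    intro i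
    rcases ((analyticAt_J f g i _).fun_comp
      hγ.analyticAt).eventually_eq_zero_or_eventually_ne_zero with h | h
    · exfalso
      -- If `Jⁱ` vanished along the curve, so would `γᵢ' = c Jⁱ`, and the `i`-th coordinate would be
      -- locally constant.
      obtain ⟨c, -, hcJ⟩ := exists_deriv_eq_mul_J hreg hp hγ.analyticAt hγ.map_zero hγ.mem_curve
      have han := analyticAt_pi_iff.1 hγ.analyticAt i
      have hd : ∀ᶠ t in 𝓝 (0 : ℂ), HasDerivAt (fun s => γ s i) 0 t := by
        filter_upwards [h, hcJ, hγ.analyticAt.eventually_analyticAt] with t h1 h2 h3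
        have := hasDerivAt_pi.1 h3.differentiableAt.hasDerivAt i
        rwa [h2 i, h1, mul_zero] at this
      obtain ⟨ε, hε, hball⟩ := Metric.eventually_nhds_iff_ball.1 hd
      refine hnc i (γ 0 i) ?_
      filter_upwards [Metric.ball_mem_nhds 0 hε] with t ht
      exact (convex_ball (0 : ℂ) ε).is_const_of_fderivWithin_eq_zero (𝕜 := ℂ)
        (fun s hs => (hball s hs).differentiableAt.differentiableWithinAt)
        (fun s hs => by
          rw [fderivWithin_of_isOpen Metric.isOpen_ball hs]
          ext
          simp [(hball s hs).deriv]) ht (Metric.mem_ball_self hε)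
    · exact h
  exact (eventually_all.2 hJ).and (eventually_all.2 hy)

/-- Along an arc none of whose coordinates tends to infinity, the curve extends analytically. -/
theorem IsArc.exists_analyticAt_eq {f g : Poly} {γ : ℂ → Pt} (hγ : IsArc f g γ)
    (hb : ∀ i, ¬ Tendsto (fun t => γ t i) (𝓝[≠] 0) (Bornology.cobounded ℂ)) :
    ∃ η : ℂ → Pt, AnalyticAt ℂ η 0 ∧ (∀ᶠ t in 𝓝 (0 : ℂ), η t ∈ curve f g) ∧
      (∀ t ≠ 0, η t = γ t ∧ deriv η t = deriv γ t) ∧ Tendsto γ (𝓝[≠] 0) (𝓝 (η 0)) := by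
  have hlim : ∀ i, ∃ c, Tendsto (fun t => γ t i) (𝓝[≠] 0) (𝓝 c) := by
    intro i
    -- A meromorphic function without a finite limit has negative order and hence tends to infinity.
    rw [tendsto_nhds_iff_meromorphicOrderAt_nonneg (hγ.meromorphicAt i), ← not_lt,
      ← tendsto_cobounded_iff_meromorphicOrderAt_neg (hγ.meromorphicAt i)]
    exact hb i
  choose p hp using hlim
  have htend : Tendsto γ (𝓝[≠] 0) (𝓝 p) := tendsto_pi_nhds.2 hp
  have hpC : p ∈ curve f g := (isClosed_curve f g).mem_of_tendsto htend hγ.mem_curve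
  have heq : ∀ t ≠ 0, Function.update γ 0 p t = γ t := fun t ht => Function.update_of_ne ht _ _
  refine ⟨Function.update γ 0 p, ?_, ?_, fun t ht => ⟨heq t ht, ?_⟩, by simpa using htend⟩
  · rw [analyticAt_pi_iff]
    intro i
    refine MeromorphicAt.analyticAt ?_ ?_
    · refine (hγ.meromorphicAt i).congr ?_
      filter_upwards [self_mem_nhdsWithin] with t ht
      rw [heq t ht]
    · exact (continuous_apply i).continuousAt.comp (continuousAt_update_same.2 htend)
  · have := eventually_nhdsWithin_iff.1 hγ.mem_curve
    filter_upwards [this] with t ht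
    by_cases h : t = 0
    · subst h; simpa using hpC
    · rw [heq t h]; exact ht h
  · refine EventuallyEq.deriv_eq ?_
    filter_upwards [isOpen_ne.mem_nhds ht] with s hs using heq s hs

/-- The two hypotheses on `dom` enclose it between nonvanishing of all `Jⁱ` and of only those with
nonzero weight, which covers both `KsymDefined` and `KDefined`. -/
theorem isWeierstrassKernel_weightedKernel {f g : Poly} (hreg : IsRegular f g)
    (hcoord : CoordsNonconstant f g) {w : Fin 3 → ℂ} (hw : ∑ i, w i = 1) {dom : Pt → Pt → Prop}
    (hdom : ∀ x y, dom x y → (∀ i, w i ≠ 0 → J f g i x ≠ 0) ∧ ∀ i, x i ≠ y i)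
    (hdom' : ∀ x y, (∀ i, J f g i x ≠ 0) → (∀ i, x i ≠ y i) → dom x y) :
    IsWeierstrassKernel f g (weightedKernel f g w) dom where
  eventually_dom p hp q _ := by
    obtain ⟨γ, hγ, hmap⟩ := exists_isLocalParam hreg hp
    have h := eventually_nhdsWithin_iff.1 (hγ.eventually_J_ne_zero_and_ne hreg hcoord hp hmap q)
    have h' : ∀ᶠ x in 𝓝[curve f g] p, x ≠ p → dom x q := by
      rw [← hmap, eventually_map]
      filter_upwards [h] with t ht hne
      obtain ⟨h1, h2⟩ := ht fun h0 => hne (by rw [Set.mem_singleton_iff.1 h0, hγ.map_zero])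
      exact hdom' _ _ h1 h2
    rw [Set.sdiff_eq]
    filter_upwards [h'.filter_mono (nhdsWithin_mono p Set.inter_subset_left),
      self_mem_nhdsWithin] with x hx hxm
    exact hx hxm.2
  meromorphic_left γ hγ y _ := meromorphicAt_weightedKernel f g w hγ.meromorphicAt
    (fun i => MeromorphicAt.const (y i) 0) (meromorphicAt_deriv_coord hγ.meromorphicAt)
  meromorphic_right δ hδ x _ v := meromorphicAt_weightedKernel f g w
    (fun i => MeromorphicAt.const (x i) 0) hδ.meromorphicAt (fun i => MeromorphicAt.const (v i) 0)
  simple_pole p hp γ hγ := by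
    obtain ⟨A, hA, hAe⟩ := exists_analyticAt_weightedKernel_eq_add hreg hw hp hγ
    exact ⟨A, hA, hAe.mono fun z hz hd => hz (hdom _ _ hd).1 (hdom _ _ hd).2⟩
  asymptotic p hp hJ γ hγ := by
    obtain ⟨A, hA, hAe⟩ := exists_analyticAt_weightedKernel_eq_add hreg hw hp hγ
    obtain ⟨B, hB, hBe⟩ := exists_analyticAt_dx_div_eq_add hreg hp hγ hJ
    -- The kernel and `dx₁ / (x₁ - y₁)` have the same principal part `1 / (t - s)`.
    refine ⟨fun z => A z - B z, hA.sub hB, ?_⟩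
    filter_upwards [hAe, hBe] with z h1 h2 hd
    obtain ⟨hd1, hd2⟩ := hdom _ _ hd
    rw [h1 hd1 hd2, h2 fun h => hd2 0 (by rw [h])]
    ring
  no_other_pole p _ q _ hpq γ δ hγ hδ := by
    obtain ⟨A, hA, hAe⟩ := exists_analyticAt_weightedKernel_eq hreg hw hγ.analyticAt hγ.mem_curve
      hδ.analyticAt hδ.mem_curve (by rwa [hγ.map_zero, hδ.map_zero])
    exact ⟨A, hA, hAe.mono fun z hz hd => hz (hdom _ _ hd).1 (hdom _ _ hd).2⟩
  pole_location γ δ hγ hδ := by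
    by_cases h1 : ∃ i : Fin 3, Tendsto (fun t => γ t i) (𝓝[≠] 0) (Bornology.cobounded ℂ)
    · exact Or.inr (Or.inr (Or.inl h1))
    by_cases h2 : ∃ i : Fin 3, Tendsto (fun t => δ t i) (𝓝[≠] 0) (Bornology.cobounded ℂ)
    · exact Or.inr (Or.inr (Or.inr h2))
    -- The extended arcs may be constant or ramified at `0`; the absence of a pole at distinct
    -- points needs only analytic arcs.
    obtain ⟨η, hη, hηm, hηγ, hγt⟩ := hγ.exists_analyticAt_eq (not_exists.1 h1)
    obtain ⟨θ, hθ, hθm, hθδ, hδt⟩ := hδ.exists_analyticAt_eq (not_exists.1 h2)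
    by_cases hne : η 0 = θ 0
    · exact Or.inr (Or.inl ⟨η 0, hηm.self_of_nhds, hγt, by rw [hne]; exact hδt⟩)
    · left
      obtain ⟨A, hA, hAe⟩ := exists_analyticAt_weightedKernel_eq hreg hw hη hηm hθ hθm hne
      refine ⟨A, hA, hAe.mono fun z hz hz1 hz2 hd => ?_⟩
      obtain ⟨hd1, hd2⟩ := hdom _ _ hd
      rw [(hηγ _ hz1).1, (hηγ _ hz1).2, (hθδ _ hz2).1] at hz
      exact hz hd1 hd2

end SpaceCurve

theorem mainTheorem1 (f g : SpaceCurve.Poly)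
    (hreg : SpaceCurve.IsRegular f g) (hcoord : SpaceCurve.CoordsNonconstant f g) :
    (∀ p ∈ SpaceCurve.curve f g, ∃ γ : ℂ → SpaceCurve.Pt,
      SpaceCurve.IsLocalParam f g γ p ∧
        Filter.map γ (nhds 0) = nhdsWithin p (SpaceCurve.curve f g)) ∧
    SpaceCurve.IsWeierstrassKernel f g (SpaceCurve.Ksym f g) (SpaceCurve.KsymDefined f g) ∧
    SpaceCurve.IsWeierstrassKernel f g (SpaceCurve.K f g) (SpaceCurve.KDefined f g) := by
  refine ⟨fun p hp => SpaceCurve.exists_isLocalParam hreg hp, ?_, ?_⟩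
  · rw [SpaceCurve.Ksym_eq_weightedKernel]
    exact SpaceCurve.isWeierstrassKernel_weightedKernel hreg hcoord (by simp)
      (fun x y h => ⟨fun i _ => h.1 i, h.2⟩) fun x y h1 h2 => ⟨h1, h2⟩
  · rw [SpaceCurve.K_eq_weightedKernel]
    refine SpaceCurve.isWeierstrassKernel_weightedKernel hreg hcoord
      (by simp [Fin.sum_univ_three]) (fun x y h => ⟨fun i hi => ?_, h.2⟩)
      fun x y h1 h2 => ⟨h1 0, h2⟩
    fin_cases i
    · exact h.1
    · simp at hi
    · simp at hi
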